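/- Let $d\ge 0$ and let $X=(X_1,\dots,X_d)$ be a random vector in $\mathbb{R}^d$ with i.i.d. coordinates that is infinitely divisible without Gaussian component, that is, for some $\gamma\in\mathbb{R}^d$ and some Lévy measure $\nu$ on $\mathbb{R}^d$ (a Borel measure with $\nu(\{0\})=0$ and $\int(1\wedge\|u\|_2^2)\,\nu(du)<\infty$), $$\mathbb{E}e^{i\langle t,X\rangle}=\exp\Big\{i\langle t,\gamma\rangle+\int_{\mathbb{R}^d}\big(e^{i\langle t,u\rangle}-1-i\langle t,u\rangle\mathbf 1_{\|u\|_2\le 1}\big)\,\nu(du)\Big\},\qquad t\in\mathbb{R}^d,$$ where, for some nonzero one-dimensional Lévy measure $\tilde\nu$ on $\mathbb{R}$, $\nu$ is the sum over $k=1,\dots,d$ of the images of $\tilde\nu$ under the embedding of $\mathbb{R}$ as the $k$-th coordinate axis of $\mathbb{R}^d$. Let $\mathbb{E}e^{t\|X\|_2}<\infty$ for some $t>0$. Assume that $\tilde\nu$ has bounded support, and let $R=\inf\{\rho:\tilde\nu(|x|>\rho)=0\}$ and $V^2=8\int_{\mathbb{R}}|u|^2\,\tilde\nu(du)$. Then $$\mathbb{E}\big[e^{(\|X\|_2/R)\log(\lambda\|X\|_2/R)}\big]<+\infty$$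 for every $\lambda>0$ with $\lambda V^2/R^2<1/e$ (with the convention $0\log 0=0$). -/

import Mathlib

open MeasureTheory ProbabilityTheory
open scoped RealInnerProductSpace

/-- A Lévy measure on `E`: a Borel measure without atom at the origin that integrates
`1 ∧ ‖u‖ ^ 2`. -/
structure IsLevyMeasure {E : Type*} [NormedAddCommGroup E] [MeasurableSpace E]
    (ν : Measure E) : Prop where
  no_atom_zero : ν {0} = 0
  lintegral_lt_top : ∫⁻ u, ENNReal.ofReal (min 1 (‖u‖ ^ 2)) ∂ν < ⊤

/-- The Lévy–Khintchine exponent, without Gaussian part,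
`i⟨t, γ⟩ + ∫ (exp (i⟨t, u⟩) - 1 - i⟨t, u⟩ 1_{‖u‖ ≤ 1}) ν(du)`. -/
noncomputable def levyKhintchineExponent {E : Type*} [NormedAddCommGroup E]
    [InnerProductSpace ℝ E] [MeasurableSpace E] (γ : E) (ν : Measure E) (t : E) : ℂ :=
  Complex.I * (⟪t, γ⟫ : ℝ) +
    ∫ u, (Complex.exp (Complex.I * (⟪t, u⟫ : ℝ)) - 1 -
      Set.indicator (Metric.closedBall (0 : E) 1) (fun v => Complex.I * (⟪t, v⟫ : ℝ)) u) ∂ν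

/-- `μ` is the infinitely divisible law `ID(γ, 0, ν)`. -/
structure IsIDLaw {E : Type*} [NormedAddCommGroup E] [InnerProductSpace ℝ E]
    [MeasurableSpace E] (μ : Measure E) (γ : E) (ν : Measure E) : Prop where
  isProbabilityMeasure : IsProbabilityMeasure μ
  isLevyMeasure : IsLevyMeasure ν
  charFun_eq : ∀ t : E, charFun μ t = Complex.exp (levyKhintchineExponent γ ν t)

/-- The measure on `ℝ^d` supported on the axes, with a copy of `ν₁` on each axis:
`∑ k, δ₀(dx_1) ⋯ δ₀(dx_{k-1}) ν₁(dx_k) δ₀(dx_{k+1}) ⋯ δ₀(dx_d)`. -/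
noncomputable def axesMeasure (d : ℕ) (ν₁ : Measure ℝ) : Measure (EuclideanSpace ℝ (Fin d)) :=
  ∑ k : Fin d, ν₁.map (fun x : ℝ => EuclideanSpace.single k x)

/-- `inf {ρ : ν₁(|x| > ρ) = 0}`. -/
noncomputable def supportRadius (ν₁ : Measure ℝ) : ℝ :=
  sInf {ρ : ℝ | ν₁ {x : ℝ | ρ < |x|} = 0}

/-!
The exponent `r log (λ r)`, with `r = ‖X‖ / R`, is handled one coordinate at a time.

For vectors `y` with nonnegative entries and Euclidean norm `r`, and any `κ > 1`,
`r log (λ r) ≤ C + ∑ y_i log (κ λ y_i)` (`exists_mul_log_le_sum`): near a coordinate axis a single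
entry carries the whole norm and the factor `κ` absorbs the entropy of the others, while away from
the axes `∑ y_i` exceeds `r` by a definite factor and the logarithm does the rest. By independence
the expectation is therefore bounded by a product of the one-dimensional expectations of
`exp (y_k log (κ λ y_k))` with `y_k = |X_k| / R`. The constant `8` in `V²` allows `κ = 8`, which
leaves the one-dimensional condition `κ λ (σ² / R²) e < 1` with `σ² = ∫ u² dν₁`.

In dimension one, the Lévy measure sits in `[-R, R]`, so the Lévy–Khintchine exponent is entire
and its values on the real axis are at most `(σ² / R²) exp (|t| R) + O(|t|)`. Since the moment generating
function of `X_k` is finite near `0`, it agrees there with the exponential of that entire function;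
the Taylor series at `0` of the latter converges everywhere, which yields all exponential moments
(`integrable_exp_mul_of_charFun_entire`) and then the bound on them (`IsIDLaw.mgf_le`). A Chernoff
argument with a level depending on `⌊y⌋` converts this Poissonian growth into
`E exp (y log (b y)) < ∞` for `b (σ² / R²) e < 1`
(`integrable_exp_mul_log_of_integral_exp_le`).
-/

/-! ### The Lévy–Khintchine exponent on the line -/

/-- The integrand `exp (z u) - 1 - z u 1_{|u| ≤ 1}` of the Lévy–Khintchine exponent on the line,
with `z` an arbitrary complex number (`z = I t` in the characteristic function). -/
noncomputable def levyKernel (z : ℂ) (u : ℝ) : ℂ :=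
  Complex.exp (z * u) - 1 - Set.indicator (Metric.closedBall (0 : ℝ) 1) (fun v : ℝ => z * v) u

lemma measurable_levyKernel (z : ℂ) : Measurable (levyKernel z) := by
  unfold levyKernel
  refine Measurable.sub (by fun_prop) ?_
  exact Measurable.indicator (by fun_prop) Metric.isClosed_closedBall.measurableSet

/-- The part of the kernel left after removing the full linear term lives on `1 < |u|`, where
`|u| ≤ u ^ 2`. -/
lemma norm_sub_indicator_closedBall_le (w : ℂ) (u : ℝ) :
    ‖w * u - Set.indicator (Metric.closedBall (0 : ℝ) 1) (fun v : ℝ => w * v) u‖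
      ≤ ‖w‖ * u ^ 2 := by
  by_cases hu : u ∈ Metric.closedBall (0 : ℝ) 1
  · rw [Set.indicator_of_mem hu, sub_self, norm_zero]; positivity
  · rw [Set.indicator_of_notMem hu, sub_zero, norm_mul, Complex.norm_real, Real.norm_eq_abs]
    have : 1 < |u| := by simpa using hu
    rw [← sq_abs u]
    gcongr
    nlinarith

lemma norm_levyKernel_le (z : ℂ) {u R : ℝ} (hu : |u| ≤ R) :
    ‖levyKernel z u‖ ≤ (‖z‖ ^ 2 * Real.exp (‖z‖ * R) + ‖z‖) * u ^ 2 := by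
  have h1 := Complex.norm_exp_sub_sum_le_norm_mul_exp (z * u) 2
  simp only [Finset.sum_range_succ, Finset.sum_range_zero, pow_zero, Nat.factorial, Nat.cast_one,
    div_one, zero_add, pow_one, mul_one, norm_mul, Complex.norm_real, Real.norm_eq_abs] at h1
  have h2 := norm_sub_indicator_closedBall_le z u
  have h3 : Real.exp (‖z‖ * |u|) ≤ Real.exp (‖z‖ * R) := by gcongr
  calc ‖levyKernel z u‖
      = ‖(Complex.exp (z * u) - (1 + z * u)) +
          (z * u - Set.indicator (Metric.closedBall (0 : ℝ) 1) (fun v : ℝ => z * v) u)‖ := by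
        unfold levyKernel; congr 1; ring
    _ ≤ (‖z‖ * |u|) ^ 2 * Real.exp (‖z‖ * |u|) + ‖z‖ * u ^ 2 :=
        (norm_add_le _ _).trans (add_le_add h1 h2)
    _ ≤ (‖z‖ * |u|) ^ 2 * Real.exp (‖z‖ * R) + ‖z‖ * u ^ 2 := by gcongr
    _ = _ := by rw [mul_pow, sq_abs]; ring

lemma integrable_levyKernel {ν : Measure ℝ} {R : ℝ} (hR : ∀ᵐ u ∂ν, |u| ≤ R)
    (hsq : Integrable (fun u => u ^ 2) ν) (z : ℂ) : Integrable (levyKernel z) ν := by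
  refine Integrable.mono' (hsq.const_mul (‖z‖ ^ 2 * Real.exp (‖z‖ * R) + ‖z‖))
    (measurable_levyKernel z).aestronglyMeasurable ?_
  filter_upwards [hR] with u hu using norm_levyKernel_le z hu

/-- For a Lévy measure of bounded support the Lévy–Khintchine exponent extends to an entire
function. -/
lemma differentiable_integral_levyKernel {ν : Measure ℝ} {R : ℝ} (hR : ∀ᵐ u ∂ν, |u| ≤ R)
    (hsq : Integrable (fun u => u ^ 2) ν) :
    Differentiable ℂ (fun z => ∫ u, levyKernel z u ∂ν) := by
  intro z₀
  let F' : ℂ → ℝ → ℂ := fun z u =>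
    Complex.exp (z * u) * u - Set.indicator (Metric.closedBall (0 : ℝ) 1) (fun v : ℝ => 1 * (v : ℂ)) u
  let B : ℝ := ‖z₀‖ + 1
  have hB : 0 ≤ B := by positivity
  refine (hasDerivAt_integral_of_dominated_loc_of_deriv_le (F := levyKernel) (F' := F')
    (bound := fun u => (B * Real.exp (B * R) + 1) * u ^ 2) (Metric.ball_mem_nhds z₀ one_pos)
    (Filter.Eventually.of_forall fun z => (measurable_levyKernel z).aestronglyMeasurable)
    (integrable_levyKernel hR hsq z₀) ?_ ?_ (hsq.const_mul _) ?_).2.differentiableAt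
  · refine Measurable.aestronglyMeasurable (Measurable.sub (by fun_prop) ?_)
    exact Measurable.indicator (by fun_prop) Metric.isClosed_closedBall.measurableSet
  · filter_upwards [hR] with u hu z hz
    have hzB : ‖z‖ ≤ B := by
      have : ‖z - z₀‖ < 1 := by simpa [dist_eq_norm] using hz
      calc ‖z‖ = ‖z₀ + (z - z₀)‖ := by congr 1; ring
        _ ≤ ‖z₀‖ + ‖z - z₀‖ := norm_add_le _ _
        _ ≤ B := by linarith
    have h1 := Complex.norm_exp_sub_sum_le_norm_mul_exp (z * u) 1
    simp only [Finset.sum_range_succ, Finset.sum_range_zero, pow_zero, Nat.factorial, Nat.cast_one,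
      div_one, zero_add, pow_one, norm_mul, Complex.norm_real, Real.norm_eq_abs] at h1
    have h2 := norm_sub_indicator_closedBall_le 1 u
    have h3 : Real.exp (‖z‖ * |u|) ≤ Real.exp (B * R) := by gcongr
    calc ‖F' z u‖ = ‖(Complex.exp (z * u) - 1) * u + (1 * u -
            Set.indicator (Metric.closedBall (0 : ℝ) 1) (fun v : ℝ => 1 * (v : ℂ)) u)‖ := by
          simp only [F']; congr 1; ring
      _ ≤ ‖(Complex.exp (z * u) - 1) * u‖ + ‖(1 : ℂ)‖ * u ^ 2 :=
          (norm_add_le _ _).trans (add_le_add le_rfl h2)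
      _ ≤ ‖z‖ * |u| * Real.exp (‖z‖ * |u|) * |u| + ‖(1 : ℂ)‖ * u ^ 2 := by
          rw [norm_mul, Complex.norm_real, Real.norm_eq_abs]; gcongr
      _ ≤ B * |u| * Real.exp (B * R) * |u| + ‖(1 : ℂ)‖ * u ^ 2 := by gcongr
      _ = _ := by rw [norm_one, ← sq_abs u]; ring
  · refine Filter.Eventually.of_forall fun u z _ => ?_
    have h1 : HasDerivAt (fun z : ℂ => z * u) (1 * u) z := (hasDerivAt_id z).mul_const _
    have h2 := (h1.cexp.sub_const 1)
    simp only [one_mul] at h2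
    unfold levyKernel
    simp only [F']
    refine h2.sub ?_
    by_cases hu : u ∈ Metric.closedBall (0 : ℝ) 1
    · simpa only [Set.indicator_of_mem hu] using h1
    · simp only [Set.indicator_of_notMem hu]; exact hasDerivAt_const z 0

/-- Second-order bound with the sharp constant `u ^ 2 / R ^ 2`: in the series of `exp (t u)` every
term past the linear one has a factor `u ^ 2`, and the others are bounded by powers of `R`. -/
lemma exp_mul_sub_one_sub_le {t u R : ℝ} (hR : 0 < R) (hu : |u| ≤ R) :
    Real.exp (t * u) - 1 - t * u ≤ u ^ 2 / R ^ 2 * Real.exp (|t| * R) := by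
  have hs1 := (NormedSpace.expSeries_div_hasSum_exp (t * u)).mul_left (R ^ 2)
  have hs2 := (NormedSpace.expSeries_div_hasSum_exp (|t| * R)).mul_left (u ^ 2)
  rw [← Real.exp_eq_exp_ℝ] at hs1 hs2
  rw [← hasSum_nat_add_iff' 2] at hs1 hs2
  have h := hasSum_le (fun n => ?_) hs1 hs2
  · simp only [Finset.sum_range_succ, Finset.sum_range_zero, pow_zero, Nat.factorial, Nat.cast_one,
      div_one, zero_add, pow_one, mul_one] at h
    have : 0 ≤ u ^ 2 * (|t| * R) := by positivity
    have hu2 := sq_nonneg u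
    rw [div_mul_eq_mul_div, le_div_iff₀ (by positivity)]
    nlinarith
  · have e : (t * u) ^ (n + 2) ≤ |t| ^ (n + 2) * (R ^ n * u ^ 2) := by
      calc (t * u) ^ (n + 2) ≤ |(t * u) ^ (n + 2)| := le_abs_self _
        _ = |t| ^ (n + 2) * (|u| ^ n * u ^ 2) := by
          rw [abs_pow, abs_mul, mul_pow, pow_add |u|, sq_abs]
        _ ≤ _ := by gcongr
    simp only [← mul_div_assoc]
    refine div_le_div_of_nonneg_right ?_ (by positivity)
    calc R ^ 2 * (t * u) ^ (n + 2) ≤ R ^ 2 * (|t| ^ (n + 2) * (R ^ n * u ^ 2)) := by gcongr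
      _ = _ := by ring

/-- Upper bound on the exponent at real arguments; the leading coefficient
`(∫ u ^ 2) / R ^ 2` of `exp (|t| R)` is the one that matters. -/
lemma re_integral_levyKernel_le {ν : Measure ℝ} {R : ℝ} (hR0 : 0 < R) (hR : ∀ᵐ u ∂ν, |u| ≤ R)
    (hsq : Integrable (fun u => u ^ 2) ν) (t : ℝ) :
    (∫ u, levyKernel t u ∂ν).re ≤
      |t| * (∫ u, u ^ 2 ∂ν) + (∫ u, u ^ 2 ∂ν) / R ^ 2 * Real.exp (|t| * R) := by
  have hi := integrable_levyKernel hR hsq (t : ℂ)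
  have e : |t| * (∫ u, u ^ 2 ∂ν) + (∫ u, u ^ 2 ∂ν) / R ^ 2 * Real.exp (|t| * R) =
      ∫ u, (|t| + Real.exp (|t| * R) / R ^ 2) * u ^ 2 ∂ν := by
    rw [integral_const_mul]; ring
  rw [e]
  rw [← RCLike.re_eq_complex_re, ← integral_re hi]
  refine integral_mono_ae hi.re (hsq.const_mul _) ?_
  filter_upwards [hR] with u hu
  have h1 := exp_mul_sub_one_sub_le (t := t) hR0 hu
  have h2 := (Complex.re_le_norm _).trans (norm_sub_indicator_closedBall_le (t : ℂ) u)
  have h3 : (Complex.exp ((t : ℂ) * u)).re = Real.exp (t * u) := by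
    rw [← Complex.ofReal_mul, Complex.exp_ofReal_re]
  rw [Complex.sub_re, ← Complex.ofReal_mul, Complex.ofReal_re, Complex.norm_real,
    Real.norm_eq_abs] at h2
  change (levyKernel t u).re ≤ _
  rw [levyKernel, Complex.sub_re, Complex.sub_re, h3, Complex.one_re]
  calc _ ≤ |t| * u ^ 2 + u ^ 2 / R ^ 2 * Real.exp (|t| * R) := by linarith
    _ = _ := by ring

/-! ### Exponential moments of one-dimensional infinitely divisible laws -/

/-- If the moment generating function of `Y` is finite near `0` and coincides on the imaginary axis
with an entire function `G`, it coincides with `G` on its whole strip of analyticity. -/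
lemma complexMGF_eqOn_of_charFun_eq {Ω : Type*} [MeasurableSpace Ω] {P : Measure Ω}
    {Y : Ω → ℝ} (hY : AEMeasurable Y P)
    (h0 : 0 ∈ interior (integrableExpSet Y P)) {G : ℂ → ℂ} (hG : Differentiable ℂ G)
    (hchar : ∀ s : ℝ, charFun (P.map Y) s = G (s * Complex.I)) :
    Set.EqOn (complexMGF Y P) G {z | z.re ∈ interior (integrableExpSet Y P)} := by
  refine AnalyticOnNhd.eqOn_of_preconnected_of_frequently_eq (z₀ := 0) analyticOnNhd_complexMGF
    (fun z _ => hG.analyticAt z) ?_ (by simpa using h0) ?_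
  · exact (convex_integrableExpSet.interior.is_linear_preimage
      Complex.reLm.isLinear).isPreconnected
  · have ht : Filter.Tendsto (fun s : ℝ => (s : ℂ) * Complex.I) (nhdsWithin 0 {0}ᶜ)
        (nhdsWithin 0 {0}ᶜ) := by
      refine tendsto_nhdsWithin_iff.2 ⟨?_, ?_⟩
      · have : Continuous (fun s : ℝ => (s : ℂ) * Complex.I) := by fun_prop
        exact (this.tendsto' 0 0 (by simp)).mono_left nhdsWithin_le_nhds
      · filter_upwards [self_mem_nhdsWithin] with s hs
        simpa using hs
    refine ht.frequently (Filter.Eventually.of_forall fun s => ?_).frequently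
    rw [← hchar, complexMGF_mul_I hY]

/-- Domination by a pointwise series of nonnegative functions with summable integrals. -/
lemma integrable_of_le_tsum {Ω : Type*} [MeasurableSpace Ω] {P : Measure Ω} {f : Ω → ℝ}
    {F : ℕ → Ω → ℝ} (hf : AEStronglyMeasurable f P) (hF : ∀ n, Integrable (F n) P)
    (hF0 : ∀ n ω, 0 ≤ F n ω) (hsum : Summable fun n => ∫ ω, F n ω ∂P)
    (hle : ∀ ω, ‖f ω‖ₑ ≤ ∑' n, ENNReal.ofReal (F n ω)) : Integrable f P := by
  refine ⟨hf, (lintegral_mono hle).trans_lt ?_⟩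
  rw [lintegral_tsum fun n => (hF n).aemeasurable.ennreal_ofReal]
  have : ∀ n, ∫⁻ ω, ENNReal.ofReal (F n ω) ∂P = ENNReal.ofReal (∫ ω, F n ω ∂P) := fun n =>
    (ofReal_integral_eq_lintegral_ofReal (hF n) (Filter.Eventually.of_forall (hF0 n))).symm
  simp only [this]
  exact hsum.tsum_ofReal_lt_top

/-- If the moment generating function of `Y` is finite near `0` and the characteristic function of
`Y` extends to an entire function `G`, then all exponential moments of `Y` are finite: the Taylor
coefficients of `G` at `0` are the moments of `Y` divided by factorials, the Taylor series of an
entire function converges everywhere, and its even part dominates `exp (t Y)`. -/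
lemma integrable_exp_mul_of_charFun_entire {Ω : Type*} [MeasurableSpace Ω] {P : Measure Ω}
    [IsFiniteMeasure P] {Y : Ω → ℝ} (hY : Measurable Y)
    (h0 : 0 ∈ interior (integrableExpSet Y P)) {G : ℂ → ℂ} (hG : Differentiable ℂ G)
    (hchar : ∀ s : ℝ, charFun (P.map Y) s = G (s * Complex.I)) (t : ℝ) :
    Integrable (fun ω => Real.exp (t * Y ω)) P := by
  have heq := complexMGF_eqOn_of_charFun_eq hY.aemeasurable h0 hG hchar
  have hopen : IsOpen {z : ℂ | z.re ∈ interior (integrableExpSet Y P)} :=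
    isOpen_interior.preimage Complex.continuous_re
  have hnhds : complexMGF Y P =ᶠ[nhds 0] G :=
    heq.eventuallyEq_of_mem (hopen.mem_nhds (by simpa using h0))
  have hderiv : ∀ n, iteratedDeriv n G 0 = ((∫ ω, Y ω ^ n ∂P : ℝ) : ℂ) := fun n => by
    rw [← hnhds.iteratedDeriv_eq n, iteratedDeriv_complexMGF (by simpa using h0)]
    simp only [zero_mul, Complex.exp_zero, mul_one]
    rw [← integral_complex_ofReal]
    simp
  have hmom : ∀ n, Integrable (fun ω => Y ω ^ n) P :=
    fun n => integrable_pow_of_mem_interior_integrableExpSet h0 n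
  have hsum : Summable (fun n : ℕ => (∫ ω, Y ω ^ (2 * n) ∂P) * t ^ (2 * n) / (2 * n).factorial) := by
    have h1 := (Complex.hasSum_taylorSeries_of_entire hG 0 (t : ℂ)).summable
    have h2 : Summable (fun n : ℕ => (∫ ω, Y ω ^ n ∂P) * t ^ n / n.factorial) := by
      refine (Complex.summable_ofReal).1 (h1.congr fun n => ?_)
      rw [hderiv]
      simp only [sub_zero, smul_eq_mul]
      push_cast
      field_simp
    exact h2.comp_injective (i := fun n : ℕ => 2 * n) (mul_right_injective₀ two_ne_zero)
  have hcosh : Integrable (fun ω => Real.cosh (t * Y ω)) P := by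
    have hF : ∀ n : ℕ, Integrable (fun ω => (t * Y ω) ^ (2 * n) / (2 * n).factorial) P := fun n => by
      simp only [mul_pow]
      exact ((hmom (2 * n)).const_mul _).div_const _
    have hF0 : ∀ (n : ℕ) ω, 0 ≤ (t * Y ω) ^ (2 * n) / (2 * n).factorial := fun n ω =>
      div_nonneg (Even.pow_nonneg (even_two_mul n) _) (by positivity)
    refine integrable_of_le_tsum (by fun_prop) hF hF0 (hsum.congr fun n => ?_) fun ω => ?_
    · rw [mul_div_assoc, ← integral_mul_const]
      refine integral_congr_ae (Filter.Eventually.of_forall fun ω => ?_)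
      simp only [mul_pow]
      ring
    · have h := Real.hasSum_cosh (t * Y ω)
      rw [Real.enorm_of_nonneg (Real.cosh_pos _).le, ← h.tsum_eq,
        ENNReal.ofReal_tsum_of_nonneg (fun n => hF0 n ω) h.summable]
  refine (hcosh.const_mul 2).mono' (by fun_prop) (Filter.Eventually.of_forall fun ω => ?_)
  rw [Real.norm_of_nonneg (Real.exp_pos _).le, Real.cosh_eq]
  linarith [Real.exp_pos (-(t * Y ω))]

/-- Exponential moments of a one-dimensional infinitely divisible variable whose Lévy measure is
carried by `[-R, R]`, once its moment generating function is finite near `0`. -/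
lemma IsIDLaw.mgf_le {Ω : Type*} [MeasurableSpace Ω] {P : Measure Ω}
    [IsProbabilityMeasure P] {Y : Ω → ℝ} (hY : Measurable Y)
    (h0 : 0 ∈ interior (integrableExpSet Y P)) {g R : ℝ} {ν : Measure ℝ}
    (hlaw : IsIDLaw (P.map Y) g ν) (hR0 : 0 < R) (hR : ∀ᵐ u ∂ν, |u| ≤ R)
    (hsq : Integrable (fun u => u ^ 2) ν) (t : ℝ) :
    Integrable (fun ω => Real.exp (t * Y ω)) P ∧
      mgf Y P t ≤ Real.exp (|t| * (|g| + ∫ u, u ^ 2 ∂ν) +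
        (∫ u, u ^ 2 ∂ν) / R ^ 2 * Real.exp (|t| * R)) := by
  let G : ℂ → ℂ := fun z => Complex.exp (z * g + ∫ u, levyKernel z u ∂ν)
  have hG : Differentiable ℂ G :=
    ((differentiable_id.mul_const _).add (differentiable_integral_levyKernel hR hsq)).cexp
  have hchar : ∀ s : ℝ, charFun (P.map Y) s = G (s * Complex.I) := fun s => by
    rw [hlaw.charFun_eq, levyKhintchineExponent]
    have hinner : ∀ u : ℝ, ((⟪s, u⟫ : ℝ) : ℂ) = s * u := fun u => by
      simp [mul_comm]
    have hcomm : ∀ u : ℝ, Complex.I * ((s : ℂ) * u) = s * Complex.I * u := fun u => by ring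
    simp only [hinner, G, levyKernel, hcomm]
  have hint := integrable_exp_mul_of_charFun_entire hY h0 hG hchar
  refine ⟨hint t, ?_⟩
  have huniv : integrableExpSet Y P = Set.univ := Set.eq_univ_of_forall hint
  have heq := complexMGF_eqOn_of_charFun_eq hY.aemeasurable h0 hG hchar
  have ht : complexMGF Y P t = G t := heq (by simp [huniv])
  have hb := re_integral_levyKernel_le hR0 hR hsq t
  have hg : t * g ≤ |t| * |g| := by rw [← abs_mul]; exact le_abs_self _
  calc mgf Y P t ≤ ‖complexMGF Y P t‖ := by
        rw [complexMGF_ofReal, Complex.norm_real]; exact le_abs_self _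
    _ = Real.exp (t * g + (∫ u, levyKernel t u ∂ν).re) := by
        rw [ht, Complex.norm_exp, Complex.add_re, ← Complex.ofReal_mul, Complex.ofReal_re]
    _ ≤ _ := Real.exp_le_exp.2 (by linarith)

/-- `E exp (s |Y|) ≤ 2 exp (c |s| + (σ² / R²) exp (s R))` for every real `s`; for negative `s` the
bound is trivial. -/
lemma IsIDLaw.integral_exp_mul_abs_le {Ω : Type*} [MeasurableSpace Ω] {P : Measure Ω}
    [IsProbabilityMeasure P] {Y : Ω → ℝ} (hY : Measurable Y)
    (h0 : 0 ∈ interior (integrableExpSet Y P)) {g R : ℝ} {ν : Measure ℝ}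
    (hlaw : IsIDLaw (P.map Y) g ν) (hR0 : 0 < R) (hR : ∀ᵐ u ∂ν, |u| ≤ R)
    (hsq : Integrable (fun u => u ^ 2) ν) (s : ℝ) :
    Integrable (fun ω => Real.exp (s * |Y ω|)) P ∧
      ∫ ω, Real.exp (s * |Y ω|) ∂P ≤ 2 * Real.exp (|s| * (|g| + ∫ u, u ^ 2 ∂ν) +
        (∫ u, u ^ 2 ∂ν) / R ^ 2 * Real.exp (s * R)) := by
  have hV : 0 ≤ ∫ u, u ^ 2 ∂ν := integral_nonneg fun u => sq_nonneg u
  have hM := fun t => IsIDLaw.mgf_le hY h0 hlaw hR0 hR hsq t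
  have hpos : ∀ ω, Real.exp (s * |Y ω|) ≤ Real.exp (s * Y ω) + Real.exp (-s * Y ω) := fun ω => by
    rcases abs_choice (Y ω) with h | h <;> rw [h]
    · linarith [Real.exp_pos (-s * Y ω)]
    · rw [neg_mul, ← mul_neg]; linarith [Real.exp_pos (s * Y ω)]
  have hint : Integrable (fun ω => Real.exp (s * |Y ω|)) P := by
    refine ((hM s).1.add (hM (-s)).1).mono' (by fun_prop) (Filter.Eventually.of_forall fun ω => ?_)
    rw [Real.norm_of_nonneg (Real.exp_pos _).le]
    exact hpos ω
  refine ⟨hint, ?_⟩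
  rcases le_total 0 s with hs | hs
  · have h1 := (hM s).2
    have h2 := (hM (-s)).2
    rw [abs_neg] at h2
    have h3 : ∫ ω, Real.exp (s * |Y ω|) ∂P ≤ mgf Y P s + mgf Y P (-s) := by
      simp only [mgf]
      rw [← integral_add (hM s).1 (hM (-s)).1]
      exact integral_mono hint ((hM s).1.add (hM (-s)).1) hpos
    rw [abs_of_nonneg hs] at *
    linarith
  · have h1 : ∫ ω, Real.exp (s * |Y ω|) ∂P ≤ ∫ _, (1 : ℝ) ∂P := by
      refine integral_mono hint (integrable_const _) fun ω => ?_
      exact Real.exp_le_one_iff.2 (mul_nonpos_of_nonpos_of_nonneg hs (abs_nonneg _))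
    have h2 : 1 ≤ Real.exp (|s| * (|g| + ∫ u, u ^ 2 ∂ν) +
        (∫ u, u ^ 2 ∂ν) / R ^ 2 * Real.exp (s * R)) := Real.one_le_exp (by positivity)
    simp only [integral_const, probReal_univ, smul_eq_mul, mul_one] at h1
    linarith

/-! ### From Laplace transforms to the moment of `exp (y log (b y))` -/

/-- With `n = ⌊y⌋`, the growth `(b y) ^ y` is dominated by `(b a) ^ n exp (s y)` at the level
`s = log ((n + 1) / a)` that optimizes Chernoff's bound. -/
lemma mul_log_le_floor {a b y : ℝ} (ha : 0 < a) (hb : 0 < b) (hab : b * a ≤ 1) (hy : 0 ≤ y) :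
    y * Real.log (b * y) ≤
      ⌊y⌋₊ * Real.log (b * a) + Real.log ((⌊y⌋₊ + 1) / a) * y := by
  rcases hy.eq_or_lt with rfl | hy0
  · simp
  have h1 : Real.log (b * y) = Real.log (b * a) + Real.log (y / a) := by
    rw [← Real.log_mul (by positivity) (by positivity)]; congr 1; field_simp
  have h2 : Real.log (b * a) ≤ 0 := Real.log_nonpos (by positivity) hab
  have h3 : Real.log (y / a) ≤ Real.log ((⌊y⌋₊ + 1) / a) := by
    have := (Nat.lt_floor_add_one y).le
    gcongr
  have h4 := Nat.floor_le hy
  rw [h1]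
  nlinarith

lemma summable_add_one_pow_mul_geometric (K : ℕ) {r : ℝ} (hr0 : 0 < r) (hr1 : r < 1) :
    Summable fun n : ℕ => ((n : ℝ) + 1) ^ K * r ^ n := by
  have h := (summable_nat_add_iff 1).2 (summable_pow_mul_geometric_of_norm_lt_one K
    (r := r) (by rwa [Real.norm_of_nonneg hr0.le]))
  refine (h.mul_right r⁻¹).congr fun n => ?_
  push_cast
  rw [pow_succ]
  field_simp

/-- Poissonian growth `log E exp (s Z) ≤ a exp s + O(|s|)` of the Laplace transform of `Z ≥ 0` gives
`E (b Z) ^ Z < ∞` for all `b < 1 / (a e)`. -/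
lemma integrable_exp_mul_log_of_integral_exp_le {Ω : Type*} [MeasurableSpace Ω] {P : Measure Ω}
    {Z : Ω → ℝ} (hZ : Measurable Z) (hZ0 : ∀ ω, 0 ≤ Z ω) {a b c A : ℝ} (ha : 0 < a) (hb : 0 < b)
    (hc : 0 ≤ c) (hA : 0 ≤ A) (hab : b * a * Real.exp 1 < 1)
    (hint : ∀ s, Integrable (fun ω => Real.exp (s * Z ω)) P)
    (hexp : ∀ s, ∫ ω, Real.exp (s * Z ω) ∂P ≤ A * Real.exp (|s| * c + a * Real.exp s)) :
    Integrable (fun ω => Real.exp (Z ω * Real.log (b * Z ω))) P := by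
  have hab1 : b * a ≤ 1 := by
    have := Real.one_le_exp zero_le_one
    nlinarith [mul_pos hb ha]
  set s : ℕ → ℝ := fun n => Real.log ((n + 1) / a)
  refine integrable_of_le_tsum
    (F := fun n ω => Real.exp (n * Real.log (b * a)) * Real.exp (s n * Z ω))
    (by fun_prop) (fun n => (hint _).const_mul _) (fun n ω => by positivity) ?_ fun ω => ?_
  · have hS := (summable_add_one_pow_mul_geometric ⌈c⌉₊ (by positivity) hab).mul_left
      (A * Real.exp (|Real.log a| * c) * Real.exp 1)
    refine Summable.of_nonneg_of_le (fun n => integral_nonneg fun ω => by positivity)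
      (fun n => ?_) hS
    rw [integral_const_mul]
    have hn : (0 : ℝ) < n + 1 := by positivity
    have h1 : a * Real.exp (s n) = n + 1 := by
      rw [Real.exp_log (by positivity)]; field_simp
    have h2 : |s n| ≤ Real.log (n + 1) + |Real.log a| := by
      simp only [s]
      rw [Real.log_div (by positivity) (by positivity)]
      refine (abs_sub _ _).trans ?_
      rw [abs_of_nonneg (Real.log_nonneg (by linarith [(Nat.cast_nonneg n : (0 : ℝ) ≤ n)]))]
    have h3 : Real.exp (Real.log (n + 1) * c) ≤ ((n : ℝ) + 1) ^ ⌈c⌉₊ := by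
      rw [← Real.exp_log hn, ← Real.exp_nat_mul, Real.log_exp, mul_comm (⌈c⌉₊ : ℝ)]
      refine Real.exp_le_exp.2 (mul_le_mul_of_nonneg_left (Nat.le_ceil c) ?_)
      exact Real.log_nonneg (by linarith [(Nat.cast_nonneg n : (0 : ℝ) ≤ n)])
    have h4 : Real.exp (n * Real.log (b * a)) = (b * a) ^ n := by
      rw [Real.exp_nat_mul, Real.exp_log (by positivity)]
    calc _ ≤ (b * a) ^ n * (A * Real.exp (|s n| * c + a * Real.exp (s n))) := by
          rw [h4]; gcongr; exact hexp _
      _ ≤ (b * a) ^ n *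
          (A * Real.exp ((Real.log (n + 1) + |Real.log a|) * c + (n * 1 + 1))) := by
          rw [h1, mul_one]; gcongr
      _ = (b * a) ^ n * (A * (Real.exp (Real.log (n + 1) * c) * Real.exp (|Real.log a| * c) *
          (Real.exp 1 ^ n * Real.exp 1))) := by
          rw [add_mul, Real.exp_add, Real.exp_add, Real.exp_add, Real.exp_nat_mul]
      _ ≤ (b * a) ^ n * (A * (((n : ℝ) + 1) ^ ⌈c⌉₊ * Real.exp (|Real.log a| * c) *
          (Real.exp 1 ^ n * Real.exp 1))) := by gcongr
      _ = _ := by rw [mul_pow (b * a)]; ring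
  · refine le_trans ?_ (ENNReal.le_tsum ⌊Z ω⌋₊)
    rw [Real.enorm_of_nonneg (Real.exp_pos _).le, ← Real.exp_add]
    exact ENNReal.ofReal_le_ofReal (Real.exp_le_exp.2 (mul_log_le_floor ha hb hab1 (hZ0 ω)))

/-! ### Superlinear growth of the Euclidean norm against the coordinates -/

lemma neg_inv_le_mul_log {m y : ℝ} (hm : 0 < m) (hy : 0 ≤ y) :
    -m⁻¹ ≤ y * Real.log (m * y) := by
  rcases hy.eq_or_lt with rfl | hy0
  · simpa using hm.le
  have h := Real.one_sub_inv_le_log_of_pos (mul_pos hm hy0)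
  have h2 := mul_le_mul_of_nonneg_left h hy
  have h3 : y * (1 - (m * y)⁻¹) = y - m⁻¹ := by field_simp
  linarith

/-- For large `L` the gain `θ (1 - θ) L` beats the entropy `-θ log θ` up to `ε`, uniformly on
`[0, 1]`. -/
lemma sq_mul_le_mul_add_log {ε L θ : ℝ} (hL : 2 ≤ L) (hε : Real.exp (-(L / 2)) ≤ ε)
    (h0 : 0 ≤ θ) (h1 : θ ≤ 1) : θ ^ 2 * L ≤ θ * (L + Real.log θ) + ε := by
  have hε0 : 0 < ε := (Real.exp_pos _).trans_le hε
  rcases h0.eq_or_lt with rfl | hθ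
  · simpa using hε0.le
  rcases le_total (1 / 2) θ with h | h
  · -- Near `1`, `θ log θ ≥ θ - 1`.
    have h2 := mul_le_mul_of_nonneg_left (Real.one_sub_inv_le_log_of_pos hθ) h0
    have h3 : θ * (1 - θ⁻¹) = θ - 1 := by field_simp
    nlinarith [mul_nonneg (sub_nonneg.2 h1) (sub_nonneg.2 hL)]
  · -- Near `0`, apply `x log x ≥ -1` to `x = θ exp (L / 2)`.
    have h2 := neg_inv_le_mul_log (m := Real.exp (L / 2)) (Real.exp_pos _) h0
    rw [Real.log_mul (Real.exp_pos _).ne' hθ.ne', Real.log_exp, ← Real.exp_neg] at h2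
    nlinarith [mul_nonneg (mul_nonneg h0 (sub_nonneg.2 h)) (by linarith : 0 ≤ L)]

/-- Up to a constant and an arbitrarily small change `κ` of the scale, the superlinear growth
`r log r` of the Euclidean norm is bounded by the sum of the growths of the coordinates. The
worst case is a vector near a coordinate axis: elsewhere the `ℓ¹` norm exceeds the `ℓ²` norm by a
definite factor. -/
lemma exists_mul_log_le_sum {ι : Type*} [Fintype ι] {b κ : ℝ} (hb : 0 < b) (hκ : 1 < κ) :
    ∃ C : ℝ, ∀ (r : ℝ) (y : ι → ℝ), 0 ≤ r → (∀ i, 0 ≤ y i) → ∑ i, y i ^ 2 = r ^ 2 →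
      r * Real.log (b * r) ≤ C + ∑ i, y i * Real.log (κ * b * y i) := by
  have hlκ := Real.log_pos hκ
  set N : ℝ := (Fintype.card ι : ℝ)
  have hN : 0 ≤ N := Nat.cast_nonneg _
  set m := κ * b
  have hm : 0 < m := by positivity
  set ε : ℝ := Real.log κ / (N + 1)
  have hε : 0 < ε := by positivity
  set L₀ : ℝ := max 2 (-2 * Real.log ε)
  have hL₀ : 2 ≤ L₀ := le_max_left _ _
  refine ⟨Real.exp L₀ / m * L₀ + N * m⁻¹, fun r y hr hy hsum => ?_⟩
  have hC : 0 ≤ Real.exp L₀ / m * L₀ + N * m⁻¹ := by positivity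
  have hlog : 0 < r → Real.log (m * r) = Real.log κ + Real.log (b * r) := fun hr0 => by
    rw [mul_assoc, Real.log_mul (by positivity) (by positivity)]
  by_cases hcase : 0 < r ∧ L₀ ≤ Real.log (m * r)
  · obtain ⟨hr0, hL⟩ := hcase
    set L := Real.log (m * r)
    have hyr : ∀ i, y i ≤ r := fun i => by
      refine abs_le_of_sq_le_sq' ?_ hr |>.2
      rw [← hsum]
      exact Finset.single_le_sum (f := fun i => y i ^ 2) (fun j _ => sq_nonneg _)
        (Finset.mem_univ i)
    have hεL : Real.exp (-(L / 2)) ≤ ε := by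
      rw [← Real.exp_log hε]
      have : -2 * Real.log ε ≤ L := (le_max_right _ _).trans hL
      exact Real.exp_le_exp.2 (by linarith)
    have hterm : ∀ i, y i ^ 2 / r * L ≤ y i * Real.log (m * y i) + ε * r := fun i => by
      rcases (hy i).eq_or_lt with h | h
      · rw [← h]; simp; positivity
      have h1 := sq_mul_le_mul_add_log (hL₀.trans hL) hεL (div_nonneg (hy i) hr)
        ((div_le_one hr0).2 (hyr i))
      have h2 : L + Real.log (y i / r) = Real.log (m * y i) := by
        rw [← Real.log_mul (by positivity) (by positivity)]; congr 1; field_simp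
      rw [h2] at h1
      calc y i ^ 2 / r * L = (y i / r) ^ 2 * L * r := by field_simp
        _ ≤ (y i / r * Real.log (m * y i) + ε) * r := by gcongr
        _ = _ := by field_simp
    have hS := Finset.sum_le_sum fun i (_ : i ∈ Finset.univ) => hterm i
    rw [← Finset.sum_mul, ← Finset.sum_div, hsum, Finset.sum_add_distrib, Finset.sum_const,
      Finset.card_univ, nsmul_eq_mul] at hS
    have h3 : r ^ 2 / r * L = r * L := by field_simp
    have h4 : N * (ε * r) ≤ r * Real.log κ := by
      have : N * ε ≤ Real.log κ := by
        simp only [ε]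
        rw [mul_div_assoc', div_le_iff₀ (by positivity)]
        nlinarith
      nlinarith
    have h5 : r * L = r * Real.log κ + r * Real.log (b * r) := by
      rw [hlog hr0]; ring
    linarith
  · have hlow : -(N * m⁻¹) ≤ ∑ i, y i * Real.log (m * y i) := by
      have := Finset.sum_le_sum fun i (_ : i ∈ Finset.univ) => neg_inv_le_mul_log hm (hy i)
      rw [Finset.sum_const, Finset.card_univ, nsmul_eq_mul] at this
      linarith
    have hup : r * Real.log (b * r) ≤ Real.exp L₀ / m * L₀ := by
      rcases hr.eq_or_lt with rfl | hr0
      · rw [zero_mul]; positivity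
      have hlt : Real.log (m * r) < L₀ := not_le.1 fun h => hcase ⟨hr0, h⟩
      have h1 : r ≤ Real.exp L₀ / m := by
        rw [le_div_iff₀ hm, mul_comm]
        exact ((Real.log_lt_iff_lt_exp (by positivity)).1 hlt).le
      have h2 : Real.log (b * r) ≤ L₀ := by linarith [hlog hr0]
      calc r * Real.log (b * r) ≤ r * L₀ := by gcongr
        _ ≤ _ := by gcongr
    linarith

/-! ### Lévy measures of bounded support and their marginals -/

/-- The infimum defining the support radius is attained and positive. -/
lemma supportRadius_pos_and_ae_le {ν : Measure ℝ} (h0 : ν {0} = 0) (hne : ν ≠ 0)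
    (hbdd : Bornology.IsBounded ν.support) :
    0 < supportRadius ν ∧ ∀ᵐ u ∂ν, |u| ≤ supportRadius ν := by
  set S : Set ℝ := {ρ : ℝ | ν {x : ℝ | ρ < |x|} = 0}
  have hpos : ∀ ρ ∈ S, 0 < ρ := fun ρ hρ => by
    by_contra! h
    refine hne (Measure.measure_univ_eq_zero.1 (measure_mono_null (fun x _ => ?_)
      (measure_union_null h0 hρ)))
    by_cases hx : x = 0
    · exact Or.inl hx
    · exact Or.inr (h.trans_lt (abs_pos.2 hx))
  have hSne : S.Nonempty := by
    obtain ⟨C, hC⟩ := hbdd.exists_norm_le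
    have hsub : {x : ℝ | C < |x|} ⊆ ν.supportᶜ := fun x hx hxs => (hC x hxs).not_gt hx
    exact ⟨C, measure_mono_null hsub Measure.measure_compl_support⟩
  have hmem : sInf S ∈ S := by
    have hsub : {x : ℝ | sInf S < |x|} ⊆ ⋃ n : ℕ, {x : ℝ | sInf S + 1 / (n + 1) < |x|} := by
      intro x hx
      obtain ⟨n, hn⟩ := exists_nat_one_div_lt (sub_pos.2 (show sInf S < |x| from hx))
      exact Set.mem_iUnion.2 ⟨n, show sInf S + 1 / (n + 1) < |x| by linarith⟩
    refine measure_mono_null hsub (measure_iUnion_null fun n => ?_)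
    obtain ⟨ρ, hρ, hlt⟩ := exists_lt_of_csInf_lt hSne
      (lt_add_of_pos_right (sInf S) (Nat.one_div_pos_of_nat (α := ℝ) (n := n)))
    exact measure_mono_null (fun x hx => hlt.trans hx) hρ
  refine ⟨hpos _ hmem, ae_iff.2 ?_⟩
  simp only [not_le]
  exact hmem

lemma IsLevyMeasure.integrable_sq {ν : Measure ℝ} (hν : IsLevyMeasure ν) {R : ℝ}
    (hR : ∀ᵐ u ∂ν, |u| ≤ R) : Integrable (fun u => u ^ 2) ν := by
  have hmin : Integrable (fun u : ℝ => min 1 (‖u‖ ^ 2)) ν := by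
    refine ⟨by fun_prop, ?_⟩
    rw [hasFiniteIntegral_iff_ofReal (Filter.Eventually.of_forall fun u => by positivity)]
    exact hν.lintegral_lt_top
  refine (hmin.const_mul (1 + R ^ 2)).mono' (by fun_prop) ?_
  filter_upwards [hR] with u hu
  have hu2 : u ^ 2 ≤ R ^ 2 := sq_le_sq' (abs_le.1 hu).1 (abs_le.1 hu).2
  rw [Real.norm_of_nonneg (sq_nonneg u), Real.norm_eq_abs, sq_abs]
  rcases min_choice 1 (u ^ 2) with h | h <;> rw [h] <;> nlinarith [sq_nonneg R, sq_nonneg u]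

lemma integral_sq_pos {ν : Measure ℝ} (h0 : ν {0} = 0) (hne : ν ≠ 0)
    (hsq : Integrable (fun u => u ^ 2) ν) : 0 < ∫ u, u ^ 2 ∂ν := by
  rw [integral_pos_iff_support_of_nonneg (fun u => sq_nonneg u) hsq, pos_iff_ne_zero]
  intro h
  refine hne (Measure.measure_univ_eq_zero.1 (measure_mono_null (fun x _ => ?_)
    (measure_union_null h0 h)))
  by_cases hx : x = 0
  · exact Or.inl hx
  · exact Or.inr (by simpa using hx)

/-- The coordinates of an infinitely divisible vector whose Lévy measure lives on the axes are
infinitely divisible: at `t = s e_k` only the `k`-th axis contributes to the exponent. -/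
lemma IsIDLaw.coord {Ω : Type*} [MeasurableSpace Ω] {P : Measure Ω} [IsProbabilityMeasure P]
    {d : ℕ} {X : Ω → EuclideanSpace ℝ (Fin d)} (hX : Measurable X) {ν : Measure ℝ}
    (hν : IsLevyMeasure ν) {R : ℝ} (hR : ∀ᵐ u ∂ν, |u| ≤ R)
    {γ : EuclideanSpace ℝ (Fin d)} (hlaw : IsIDLaw (P.map X) γ (axesMeasure d ν)) (k : Fin d) :
    IsIDLaw (P.map fun ω => X ω k) (γ k) ν := by
  have hXk : Measurable fun ω => X ω k := by fun_prop
  refine ⟨Measure.isProbabilityMeasure_map hXk.aemeasurable, hν, fun s => ?_⟩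
  have hinner : ∀ x : EuclideanSpace ℝ (Fin d), ⟪EuclideanSpace.single k s, x⟫ = ⟪s, x k⟫ :=
    fun x => by simp [EuclideanSpace.inner_single_left, mul_comm]
  have h1 : charFun (P.map fun ω => X ω k) s = charFun (P.map X) (EuclideanSpace.single k s) := by
    rw [charFun_apply, charFun_apply, integral_map hXk.aemeasurable (by fun_prop),
      integral_map hX.aemeasurable (by fun_prop)]
    refine integral_congr_ae (Filter.Eventually.of_forall fun ω => ?_)
    simp only
    rw [real_inner_comm, real_inner_comm _ (X ω), hinner]
  rw [h1, hlaw.charFun_eq, levyKhintchineExponent, levyKhintchineExponent, hinner, axesMeasure]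
  congr 2
  set f : EuclideanSpace ℝ (Fin d) → ℂ := fun u =>
    Complex.exp (Complex.I * (⟪EuclideanSpace.single k s, u⟫ : ℝ)) - 1 -
      Set.indicator (Metric.closedBall 0 1)
        (fun v => Complex.I * (⟪EuclideanSpace.single k s, v⟫ : ℝ)) u
  have hf : Measurable f :=
    Measurable.sub (by fun_prop)
      (Measurable.indicator (by fun_prop) Metric.isClosed_closedBall.measurableSet)
  have hm : ∀ j : Fin d, Measurable fun x : ℝ => EuclideanSpace.single j x := fun j =>
    (Isometry.of_dist_eq fun x y => by simp).continuous.measurable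
  have hself : ∀ u : ℝ, f (EuclideanSpace.single k u) = levyKernel (Complex.I * s) u := fun u => by
    have hmem : EuclideanSpace.single k u ∈ Metric.closedBall (0 : EuclideanSpace ℝ (Fin d)) 1 ↔
        u ∈ Metric.closedBall (0 : ℝ) 1 := by simp
    have hin : ((⟪EuclideanSpace.single k s, EuclideanSpace.single k u⟫ : ℝ) : ℂ) = s * u := by
      rw [hinner]; simp [mul_comm]
    simp only [f, levyKernel, hin, mul_assoc]
    by_cases hu : u ∈ Metric.closedBall (0 : ℝ) 1
    · rw [Set.indicator_of_mem hu, Set.indicator_of_mem (hmem.2 hu), hin]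
    · rw [Set.indicator_of_notMem hu, Set.indicator_of_notMem (fun h => hu (hmem.1 h))]
  have hother : ∀ j, j ≠ k → ∀ u : ℝ, f (EuclideanSpace.single j u) = 0 := fun j hj u => by
    have hin : ⟪EuclideanSpace.single k s, EuclideanSpace.single j u⟫ = 0 := by
      rw [hinner]; simp [hj.symm]
    simp only [f, hin]
    by_cases hu : EuclideanSpace.single j u ∈ Metric.closedBall (0 : EuclideanSpace ℝ (Fin d)) 1
    · rw [Set.indicator_of_mem hu, hin]; simp
    · rw [Set.indicator_of_notMem hu]; simp
  have hint : ∀ j : Fin d, Integrable f (ν.map fun x : ℝ => EuclideanSpace.single j x) := fun j => by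
    rw [integrable_map_measure hf.aestronglyMeasurable (hm j).aemeasurable]
    rcases eq_or_ne j k with rfl | hj
    · exact (integrable_levyKernel hR (hν.integrable_sq hR) _).congr
        (Filter.Eventually.of_forall fun u => (hself u).symm)
    · exact (integrable_zero _ _ _).congr (Filter.Eventually.of_forall fun u => (hother j hj u).symm)
  rw [integral_finsetSum_measure fun j _ => hint j, Finset.sum_eq_single k]
  · rw [integral_map (hm k).aemeasurable hf.aestronglyMeasurable]
    refine integral_congr_ae (Filter.Eventually.of_forall fun u => ?_)
    simp only [hself, levyKernel]
    have hin : ∀ u : ℝ, ((⟪s, u⟫ : ℝ) : ℂ) = s * u := fun u => by simp [mul_comm]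
    simp only [hin, mul_assoc]
  · intro j _ hj
    rw [integral_map (hm j).aemeasurable hf.aestronglyMeasurable]
    simp [hother j hj]
  · simp

/-! ### Independence and the vector-valued statement -/

lemma integrable_exp_sum_of_iIndepFun {Ω ι : Type*} [MeasurableSpace Ω] {P : Measure Ω} [Fintype ι]
    {W : ι → Ω → ℝ} (hW : ∀ i, Measurable (W i)) (hind : iIndepFun W P)
    (hint : ∀ i, Integrable (fun ω => Real.exp (W i ω)) P) :
    Integrable (fun ω => Real.exp (∑ i, W i ω)) P := by
  refine ⟨by fun_prop, ?_⟩
  rw [hasFiniteIntegral_iff_ofReal (Filter.Eventually.of_forall fun ω => (Real.exp_pos _).le)]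
  simp only [Real.exp_sum, ENNReal.ofReal_prod_of_nonneg fun i _ => (Real.exp_pos _).le]
  rw [lintegral_prod_eq_prod_lintegral_of_indepFun Finset.univ
    (fun i ω => ENNReal.ofReal (Real.exp (W i ω)))
    (hind.comp (fun _ x => ENNReal.ofReal (Real.exp x)) fun _ => by fun_prop)
    fun i => by fun_prop]
  exact ENNReal.prod_lt_top fun i _ => (hasFiniteIntegral_iff_ofReal
    (Filter.Eventually.of_forall fun ω => (Real.exp_pos _).le)).1 (hint i).2

lemma zero_mem_interior_integrableExpSet_coord {Ω : Type*} [MeasurableSpace Ω] {P : Measure Ω}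
    {d : ℕ} {X : Ω → EuclideanSpace ℝ (Fin d)} (hX : Measurable X) {t : ℝ} (ht : 0 < t)
    (hexp : Integrable (fun ω => Real.exp (t * ‖X ω‖)) P) (k : Fin d) :
    0 ∈ interior (integrableExpSet (fun ω => X ω k) P) := by
  refine mem_interior.2 ⟨Set.Ioo (-t) t, fun s hs => ?_, isOpen_Ioo, by simpa using ht⟩
  refine hexp.mono' (by fun_prop) (Filter.Eventually.of_forall fun ω => ?_)
  rw [Real.norm_of_nonneg (Real.exp_pos _).le]
  refine Real.exp_le_exp.2 ((le_abs_self _).trans ?_)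
  rw [abs_mul]
  exact mul_le_mul (abs_lt.2 hs).le (PiLp.norm_apply_le (X ω) k) (abs_nonneg _) ht.le

theorem theorem3 {Ω : Type*} [MeasurableSpace Ω] (P : Measure Ω) [IsProbabilityMeasure P]
    (d : ℕ) (X : Ω → EuclideanSpace ℝ (Fin d)) (hX : Measurable X)
    -- the coordinates are i.i.d.
    (hindep : iIndepFun (fun k ω => X ω k) P)
    (hident : ∀ j k : Fin d, IdentDistrib (fun ω => X ω j) (fun ω => X ω k) P P)
    -- `X` is infinitely divisible without Gaussian part, its Lévy measure lives on the axes
    (ν₁ : Measure ℝ) (hν₁ : IsLevyMeasure ν₁) (hν₁_ne : ν₁ ≠ 0)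
    (γ : EuclideanSpace ℝ (Fin d)) (hlaw : IsIDLaw (P.map X) γ (axesMeasure d ν₁))
    -- some exponential moment of the norm is finite
    (hexp : ∃ t : ℝ, 0 < t ∧ Integrable (fun ω => Real.exp (t * ‖X ω‖)) P)
    -- the one-dimensional Lévy measure has bounded support
    (hbdd : Bornology.IsBounded ν₁.support)
    (R : ℝ) (hR : R = supportRadius ν₁)
    (lam : ℝ) (hlam : 0 < lam)
    (hlamV : lam * (8 * ∫ u, |u| ^ 2 ∂ν₁) / R ^ 2 < 1 / Real.exp 1) :
    Integrable
      (fun ω => Real.exp ((‖X ω‖ / R) * Real.log (lam * ‖X ω‖ / R))) P := by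
  obtain ⟨t, ht, hexp⟩ := hexp
  obtain ⟨hR0, hRae⟩ := supportRadius_pos_and_ae_le hν₁.no_atom_zero hν₁_ne hbdd
  rw [← hR] at hR0 hRae
  have hsq := hν₁.integrable_sq hRae
  have hV := integral_sq_pos hν₁.no_atom_zero hν₁_ne hsq
  simp only [sq_abs] at hlamV
  set V := ∫ u, u ^ 2 ∂ν₁
  -- The factor `8` leaves room to replace `lam` by `8 * lam` in each coordinate.
  have hab : 8 * lam * (V / R ^ 2) * Real.exp 1 < 1 := by
    rw [lt_div_iff₀ (Real.exp_pos 1)] at hlamV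
    calc _ = lam * (8 * V) / R ^ 2 * Real.exp 1 := by ring
      _ < 1 := hlamV
  have hcoord : ∀ k, Integrable
      (fun ω => Real.exp (|X ω k| / R * Real.log (8 * lam * (|X ω k| / R)))) P := fun k => by
    have hM := (hlaw.coord hX hν₁ hRae k).integral_exp_mul_abs_le (by fun_prop)
      (zero_mem_interior_integrableExpSet_coord hX ht hexp k) hR0 hRae hsq
    have hscale : ∀ (s : ℝ) ω, s * (|X ω k| / R) = s / R * |X ω k| := fun s ω => by ring
    refine integrable_exp_mul_log_of_integral_exp_le (a := V / R ^ 2) (A := 2)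
      (c := (|γ k| + V) / R) (by fun_prop) (fun ω => by positivity) (by positivity)
      (by positivity) (by positivity) zero_le_two hab (fun s => ?_) fun s => ?_
    · simpa only [hscale] using (hM (s / R)).1
    · simp only [hscale]
      refine (hM (s / R)).2.trans_eq ?_
      rw [abs_div, abs_of_pos hR0, div_mul_cancel₀ s hR0.ne']
      congr 3
      ring
  have hprod := integrable_exp_sum_of_iIndepFun
    (W := fun k ω => |X ω k| / R * Real.log (8 * lam * (|X ω k| / R))) (fun k => by fun_prop)
    (hindep.comp (fun _ x => |x| / R * Real.log (8 * lam * (|x| / R))) fun _ => by fun_prop) hcoord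
  obtain ⟨C, hC⟩ := exists_mul_log_le_sum (ι := Fin d) hlam (by norm_num : (1 : ℝ) < 8)
  refine (hprod.const_mul (Real.exp C)).mono' (by fun_prop)
    (Filter.Eventually.of_forall fun ω => ?_)
  rw [Real.norm_of_nonneg (Real.exp_pos _).le, ← Real.exp_add, mul_div_assoc]
  refine Real.exp_le_exp.2 (hC _ _ (by positivity) (fun k => by positivity) ?_)
  simp only [div_pow, sq_abs]
  rw [← Finset.sum_div, EuclideanSpace.real_norm_sq_eq]
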